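/- Let $(E,\|\cdot\|)$ be a normed plane, that is, a two-dimensional real normed space, with closed discs $B(x,\lambda)=\{y:\|y-x\|\le\lambda\}$ and circles $S(x,\lambda)=\{y:\|y-x\|=\lambda\}$. Let $K\subset E$ be a finite non-empty set, let $\lambda_K$ be its circumradius (the least $\rho\ge 0$ such that $K$ lies in some disc $B(x,\rho)$), and let $\lambda>0$ with $\lambda\ge\lambda_K$. The $\lambda$-ball hull of $K$ is $$\operatorname{bh}(K,\lambda)=\bigcap_{K\subseteq B(x,\lambda)}B(x,\lambda).$$ A circular arc of radius $\lambda$ with endpoints $p\neq q$ is a simple curve from $p$ to $q$ contained in some circle $S(x,\lambda)$. It is called minimal if it lies in the closed half-plane that is bounded by the line through $p$ and $q$ and does not contain the center $x$; if $x$ lies on this line (that is, $p$ and $q$ are opposite points of the circle), both half-circles of $S(x,\lambda)$ from $p$ to $q$ are minimal. For $p=q$ the (minimal) circular arcs with endpoints $p,q$ are the one-point set $\{p\}$, on any circle of radius $\lambda$ through $p$. Let $\mathcal H$ be the set of all discs $B(x,\lambda)$ whose boundary $S(x,\lambda)$ contains a circular arc whose endpoints are two distinct points of $K$ (if $K=\{p\}$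 is a single point: all discs $B(x,\lambda)$ with $p\in S(x,\lambda)$). If the norm is strictly convex or $\lambda\ge\operatorname{diam}(K)=\max\{\|u-v\|:u,v\in K\}$, then $$\operatorname{bh}(K,\lambda)=\bigcap_{K\subseteq B(x,\lambda)\in\mathcal H}B(x,\lambda)=\operatorname{conv}\Bigl(\bigcup_{p,q\in K}\widehat{pq}\Bigr),$$ where the union is over all minimal circular arcs $\widehat{pq}$ of radius $\lambda$ with endpoints $p,q\in K$, on all circles of radius $\lambda$ through $p$ and $q$. -/

import Mathlib

open Set Metric

/-- The `r`-ball hull of `K`: the intersection of all closed balls of radius `r` containing `K`. -/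
def ballHull {E : Type*} [NormedAddCommGroup E] (K : Set E) (r : ℝ) : Set E :=
  ⋂ x ∈ {x : E | K ⊆ closedBall x r}, closedBall x r

/-- The circumradius (Chebyshev radius) of `K`: the least radius of a closed ball
containing `K`. -/
noncomputable def circumradius {E : Type*} [NormedAddCommGroup E] (K : Set E) : ℝ :=
  sInf {r : ℝ | 0 ≤ r ∧ ∃ x : E, K ⊆ closedBall x r}

/-- `A` is a circular arc with endpoints `p` and `q` on the circle `S(x, r)`: a simple
(continuous, injectively parametrized) curve from `p` to `q` running inside the circle;
if `p = q`, the arc is the single point `p`. -/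
def IsCircularArc {E : Type*} [NormedAddCommGroup E]
    (x : E) (r : ℝ) (p q : E) (A : Set E) : Prop :=
  A ⊆ sphere x r ∧
    ((p = q ∧ A = {p}) ∨
      ∃ γ : ℝ → E, ContinuousOn γ (Icc 0 1) ∧ InjOn γ (Icc 0 1) ∧
        γ 0 = p ∧ γ 1 = q ∧ γ '' Icc 0 1 = A)

/-- `A` is a minimal circular arc of `S(x, r)` meeting `p` and `q`: a circular arc with these
endpoints lying in a closed half-plane `{y | f y ≤ f p}` bounded by a line through `p` and `q`
whose interior does not contain the center. If the center is not on the line through `p ≠ q`,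
this is the half-plane not containing the center. If it is on that line
(`p` and `q` are opposite), both half-planes are allowed. -/
def IsMinimalArc {E : Type*} [NormedAddCommGroup E] [NormedSpace ℝ E]
    (x : E) (r : ℝ) (p q : E) (A : Set E) : Prop :=
  IsCircularArc x r p q A ∧
    ∃ f : E →ₗ[ℝ] ℝ, f ≠ 0 ∧ f p = f q ∧ f p ≤ f x ∧ ∀ y ∈ A, f y ≤ f p

/-- The circle `S(x, r)` contains a circular arc joining points of `K`. The endpoints have to be
distinct, unless `K` has only one point. -/
def CarriesArc {E : Type*} [NormedAddCommGroup E] (K : Set E) (x : E) (r : ℝ) : Prop :=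
  ∃ p ∈ K, ∃ q ∈ K, (K.Nontrivial → p ≠ q) ∧ ∃ A : Set E, IsCircularArc x r p q A

/-- The union of all minimal circular arcs of radius `r` meeting two points of `K`. -/
def minimalArcUnion {E : Type*} [NormedAddCommGroup E] [NormedSpace ℝ E]
    (K : Set E) (r : ℝ) : Set E :=
  {y : E | ∃ p ∈ K, ∃ q ∈ K, ∃ (x : E) (A : Set E), IsMinimalArc x r p q A ∧ y ∈ A}

/-! ### Norm comparisons obtained from linear relations -/

section NormedSpace

variable {E : Type*} [NormedAddCommGroup E] [NormedSpace ℝ E] {r : ℝ}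

/-! The ball hull trivially lies in the intersection over `CarriesArc`; three inclusions remain.

Arcs lie in the hull: the points of a minimal arc lie in the cone spanned at the center by its
endpoints, and a sphere point of this cone belongs to every ball of radius `r` containing the
endpoints (`norm_sub_le_of_mem_cone`). Strict convexity or small diameter excludes the bad case of
endpoints at distance `2 * r`.

The hull lies in the convex hull of the arcs: a point `y` outside `convexHull ℝ K` is separated from
`K` by a functional `f`. Let `z` minimize `f` over the centers of balls containing `K`. By Helly,
two points `p`, `q` of `K` already force this minimum (`exists_minimizer_pair`). Both lie on the
circle about `z`, and `y` lies between their chord and a minimal arc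
(`coeff_nonneg_of_forall_nonneg`).

The intersection over `CarriesArc` lies in the hull: the same argument works once the ball about `z`
carries an arc. To ensure this, `f` is rotated until two points of `K` maximize it
(`exists_two_maximizers_or_collinear`); the collinear exception gets its own ball. -/

theorem norm_smul_add_smul_le {x y : E} (hx : ‖x‖ ≤ r) (hy : ‖y‖ ≤ r) (a b : ℝ) :
    ‖a • x + b • y‖ ≤ (|a| + |b|) * r := by
  calc ‖a • x + b • y‖ ≤ ‖a • x‖ + ‖b • y‖ := norm_add_le _ _
    _ = |a| * ‖x‖ + |b| * ‖y‖ := by simp [norm_smul]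
    _ ≤ |a| * r + |b| * r := by gcongr
    _ = (|a| + |b|) * r := by ring

/-- The triangle inequality for a linear relation is read in two ways: here it bounds a vector, in
`le_of_smul_eq` it bounds a coefficient. The planar comparisons below combine both readings. -/
theorem norm_le_of_smul_eq {x y w : E} {a b c : ℝ} (hr : 0 ≤ r) (hx : ‖x‖ ≤ r) (hy : ‖y‖ ≤ r)
    (hc : 0 < c) (h : c • w = a • x + b • y) (habc : |a| + |b| ≤ c) : ‖w‖ ≤ r := by
  have h1 := norm_smul_add_smul_le hx hy a b
  rw [← h, norm_smul, Real.norm_of_nonneg hc.le] at h1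
  have h2 : (|a| + |b|) * r ≤ c * r := by gcongr
  exact le_of_mul_le_mul_left (h1.trans h2) hc

theorem le_of_smul_eq {x y w : E} {a b c : ℝ} (hr : 0 < r) (hx : ‖x‖ ≤ r) (hy : ‖y‖ ≤ r)
    (hw : ‖w‖ = r) (h : c • w = a • x + b • y) : c ≤ |a| + |b| := by
  have h1 := norm_smul_add_smul_le hx hy a b
  rw [← h, norm_smul, hw, Real.norm_eq_abs] at h1
  exact (le_abs_self c).trans (le_of_mul_le_mul_right h1 hr)

/-- A form of the monotonicity lemma: walking along the sphere of radius `r` from `p` to `y`,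
that is, towards the direction of `z`, one does not leave the ball of radius `r` around `z`. -/
theorem norm_sub_le_of_eq_smul_sub_smul {y p z : E} {s t : ℝ} (hr : 0 < r) (hy : ‖y‖ = r)
    (hp : ‖p‖ = r) (hpz : ‖p - z‖ ≤ r) (hs : 0 ≤ s) (ht : 0 ≤ t) (h : p = s • y - t • z) :
    ‖y - z‖ ≤ r := by
  -- These two relations yield `1 ≤ s` and `s ≤ 1 + 2 * t`, exactly the bounds on coefficient sums
  -- needed in the first and second case below.
  have h1 : 1 + t ≤ |t| + |s| :=
    le_of_smul_eq hr hpz hy.le hp (by rw [h]; module)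
  have h2 : s ≤ |t + 1| + |-t| :=
    le_of_smul_eq hr hp.le hpz hy (by rw [h]; module)
  rw [abs_of_nonneg ht, abs_of_nonneg hs] at h1
  rw [abs_neg, abs_of_nonneg ht, abs_of_nonneg (by linarith)] at h2
  rcases le_total s (1 + t) with hst | hst
  · refine norm_le_of_smul_eq (a := 1) (b := 1 + t - s) (c := 1 + t) hr.le hpz hy.le (by linarith)
      (by rw [h]; module) ?_
    rw [abs_one, abs_of_nonneg (by linarith)]
    linarith
  · refine norm_le_of_smul_eq (a := s - t) (b := 1 - s + t) (c := s) hr.le hpz hp.le (by linarith)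
      (by rw [h]; module) ?_
    rw [abs_of_nonneg (by linarith), abs_of_nonpos (by linarith)]
    linarith

/-- Points of the sphere of radius `r` between two of its points `u` and `v` lie in every ball of
radius `r` containing `u` and `v`. -/
theorem norm_sub_le_of_mem_cone {u v w z : E} {α β a b : ℝ} (hr : 0 < r) (hu : ‖u‖ = r)
    (hv : ‖v‖ = r) (hw : ‖w‖ = r) (huv : ‖u - v‖ < 2 * r) (hα : 0 ≤ α) (hβ : 0 ≤ β)
    (hwuv : w = α • u + β • v) (hz : z = a • u + b • v) (huz : ‖u - z‖ ≤ r) (hvz : ‖v - z‖ ≤ r) :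
    ‖w - z‖ ≤ r := by
  by_cases hab : a ≤ 0 ∧ b ≤ 0
  · obtain ⟨ha, hb⟩ := hab
    have h1 : 1 - a ≤ |1| + |b| := le_of_smul_eq hr huz hv.le hu (by rw [hz]; module)
    have h2 : 1 - b ≤ |1| + |a| := le_of_smul_eq hr hvz hu.le hv (by rw [hz]; module)
    rw [abs_one, abs_of_nonpos hb] at h1
    rw [abs_one, abs_of_nonpos ha] at h2
    obtain rfl : a = b := by linarith
    rcases ha.eq_or_lt with rfl | ha
    · simp [hz, hw]
    exfalso
    -- With `a = b < 0`, a functional norming `u` gives `g v ≤ -r`, hence `‖u - v‖ ≥ 2 * r`.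
    obtain ⟨g, hg, hgu⟩ := exists_dual_vector'' ℝ u
    have hgle (x : E) : g x ≤ ‖x‖ :=
      (le_abs_self _).trans <| (g.le_opNorm x).trans (mul_le_of_le_one_left (norm_nonneg x) hg)
    have h3 := (hgle (u - z)).trans huz
    have h4 := (hgle (u - v)).trans_lt huv
    simp only [hz, map_sub, map_add, map_smul, hgu, hu, smul_eq_mul, RCLike.ofReal_real_eq_id,
      id] at h3 h4
    nlinarith
  -- The sign of the determinant tells on which side of the ray through `w` the point `z` lies: `w`
  -- is between `u` and `z`, or on the ray of `z`, or between `v` and `z`.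
  rcases lt_trichotomy (a * β - α * b) 0 with hD | hD | hD
  · have hb : 0 ≤ b := by
      by_contra hb
      push Not at hb hab
      have : 0 < a := by
        by_contra ha
        exact absurd (hab (not_lt.mp ha)) (by linarith)
      nlinarith [mul_nonneg this.le hβ, mul_nonneg hα (neg_nonneg.mpr hb.le)]
    obtain ⟨D, hD'⟩ : ∃ D, D = α * b - a * β := ⟨_, rfl⟩
    have hD0 : 0 < D := by linarith
    refine norm_sub_le_of_eq_smul_sub_smul (s := b / D) (t := β / D)
      hr hw hu huz (by positivity) (by positivity) ?_
    rw [hwuv, hz]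
    match_scalars <;> (field_simp; linarith)
  · obtain ⟨c, hc, hzw⟩ : ∃ c : ℝ, 0 ≤ c ∧ z = c • w := by
      have hαβ : 0 < α + β := by
        rcases (add_nonneg hα hβ).eq_or_lt with h | h
        · obtain rfl : α = 0 := by linarith
          obtain rfl : β = 0 := by linarith
          simp only [zero_smul, add_zero] at hwuv
          simp [hwuv] at hw
          linarith
        · exact h
      have hc : 0 ≤ (a + b) / (α + β) := by
        refine div_nonneg ?_ hαβ.le
        by_contra hab'
        push Not at hab hab'
        rcases le_or_gt a 0 with ha | ha
        · have hb := hab ha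
          have h1 : α * b = 0 := by nlinarith [mul_nonneg hα hb.le]
          have : α = 0 := by simpa [hb.ne'] using h1
          subst this
          have h2 : a * β = 0 := by linarith
          rcases mul_eq_zero.mp h2 with h | h <;> linarith
        · have hb : b < 0 := by linarith
          have h1 : a * β = 0 := by nlinarith [mul_nonneg ha.le hβ]
          have : β = 0 := by simpa [ha.ne'] using h1
          subst this
          have h2 : α * b = 0 := by linarith
          rcases mul_eq_zero.mp h2 with h | h <;> linarith
      refine ⟨_, hc, ?_⟩
      rw [hwuv, hz]
      match_scalars <;> (field_simp; linarith)
    have hc2 : c ≤ |1| + |-1| := le_of_smul_eq hr hu.le huz hw (by rw [hzw]; module)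
    norm_num at hc2
    have : w - z = (1 - c) • w := by rw [hzw]; module
    rw [this, norm_smul, hw, Real.norm_eq_abs]
    have : |1 - c| ≤ 1 := abs_le.mpr ⟨by linarith, by linarith⟩
    nlinarith
  · have ha : 0 ≤ a := by
      by_contra ha
      push Not at ha hab
      have := hab ha.le
      nlinarith [mul_nonneg (neg_nonneg.mpr ha.le) hβ, mul_nonneg hα this.le]
    refine norm_sub_le_of_eq_smul_sub_smul (s := a / (a * β - α * b)) (t := α / (a * β - α * b))
      hr hw hv hvz (by positivity) (by positivity) ?_
    rw [hwuv, hz]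
    match_scalars <;> field_simp
    ring

/-- Let `f ≥ 0` on the intersection of the balls of radius `r` around the points `u` and `v` of
the sphere of radius `r`. Then a point of the ball of radius `r` with larger `f`-value than `u`
and `v` lies in the cone spanned by `u` and `v`, beyond the segment from `u` to `v`. -/
theorem coeff_nonneg_of_forall_nonneg {u v y : E} {a b : ℝ} (f : E →L[ℝ] ℝ) (hr : 0 < r)
    (hu : ‖u‖ = r) (hv : ‖v‖ = r) (hy : ‖y‖ ≤ r) (hfu : f u < f y) (hfv : f v < f y)
    (hf : ∀ d, ‖d - u‖ ≤ r → ‖d - v‖ ≤ r → 0 ≤ f d) (hyuv : y = a • u + b • v) :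
    0 ≤ a ∧ 0 ≤ b ∧ 1 ≤ a + b := by
  have huv : 0 ≤ f u + f v := by
    simpa using hf (u + v) (by simp [hv.le]) (by simp [hu.le])
  have hfy : f y = a * f u + b * f v := by simp [hyuv]
  have mixed : ∀ {u v : E} {a b : ℝ}, ‖u‖ = r → ‖v‖ = r → f u < f y → f v < f y →
      (∀ d, ‖d - u‖ ≤ r → ‖d - v‖ ≤ r → 0 ≤ f d) → 0 ≤ f u + f v → y = a • u + b • v →
      0 < a → b < 0 → False := by
    intro u v a b hu hv hfu hfv hf huv hy' ha hb
    have hfy : f y = a * f u + b * f v := by simp [hy']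
    have ha1 : a ≤ |1| + |-b| := le_of_smul_eq hr hy hv.le hu (by rw [hy']; module)
    rw [abs_one, abs_neg, abs_of_neg hb] at ha1
    have ha2 : 1 - a ≤ -b := by
      by_contra hab
      push Not at hab
      rcases le_or_gt 0 (f u) with h0 | h0
      · nlinarith
      · nlinarith
    have hab : 0 < a - b := by linarith
    -- This positive multiple of `u - y` lies in both balls, yet `f` is negative there because `f u
    -- < f y`.
    have hd : (a - b) • ((a / (a - b)) • (u - y)) = a • (u - y) := by
      rw [smul_smul, mul_div_cancel₀ _ hab.ne']
    have h1 : 0 ≤ f ((a / (a - b)) • (u - y)) := by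
      apply hf
      · refine norm_le_of_smul_eq (a := -a) (b := b) (c := a - b) hr.le hy hu.le hab
          (by rw [smul_sub, hd]; module) ?_
        rw [abs_neg, abs_of_pos ha, abs_of_neg hb]
        linarith
      · refine norm_le_of_smul_eq (a := 1 - a) (b := -a) (c := a - b) hr.le hy hv.le hab
          (by rw [smul_sub, hd, hy']; module) ?_
        rw [abs_neg, abs_of_pos ha]
        have : |1 - a| ≤ -b := abs_le.mpr ⟨by linarith, ha2⟩
        linarith
    rw [map_smul, map_sub, smul_eq_mul] at h1
    have : 0 < a / (a - b) := by positivity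
    nlinarith
  have neg : ∀ {u v : E} {a b : ℝ}, ‖u‖ = r → ‖v‖ = r → f u < f y → 0 ≤ f u + f v →
      y = a • u + b • v → a ≤ 0 → b ≤ 0 → f v ≤ f u → False := by
    intro u v a b hu hv hfu huv hy' ha hb hvu
    have hfy : f y = a * f u + b * f v := by simp [hy']
    have hb1 : -b ≤ |-1| + |a| := le_of_smul_eq hr hy hu.le hv (by rw [hy']; module)
    rw [abs_neg, abs_one, abs_of_nonpos ha] at hb1
    nlinarith
  have huv' : 0 ≤ f v + f u := by linarith
  have hyvu : y = b • v + a • u := by rw [hyuv, add_comm]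
  have ha : 0 ≤ a := by
    by_contra ha
    push Not at ha
    rcases lt_or_ge 0 b with hb | hb
    · exact mixed hv hu hfv hfu (fun d h1 h2 => hf d h2 h1) huv' hyvu hb ha
    · rcases le_total (f u) (f v) with h | h
      · exact neg hv hu hfv huv' hyvu hb ha.le h
      · exact neg hu hv hfu huv hyuv ha.le hb h
  have hb : 0 ≤ b := by
    by_contra hb
    push Not at hb
    rcases ha.eq_or_lt with ha | ha
    · rcases le_total (f u) (f v) with h | h
      · exact neg hv hu hfv huv' hyvu hb.le ha.ge h
      · exact neg hu hv hfu huv hyuv ha.ge hb.le h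
    · exact mixed hu hv hfu hfv hf huv hyuv ha hb
  refine ⟨ha, hb, ?_⟩
  rcases le_total (f u) (f v) with h | h <;> nlinarith

end NormedSpace

/-! ### Construction of minimal arcs in the plane -/

section Plane

variable {E : Type*} [NormedAddCommGroup E] [NormedSpace ℝ E] {r : ℝ}

theorem exists_eq_smul_add_smul (hE : Module.finrank ℝ E = 2) {u v : E}
    (h : LinearIndependent ℝ ![u, v]) (w : E) : ∃ a b : ℝ, w = a • u + b • v := by
  have hw : w ∈ Submodule.span ℝ (range ![u, v]) := by
    rw [h.span_eq_top_of_card_eq_finrank (by simp [hE])]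
    trivial
  simp only [Matrix.range_cons, Matrix.range_empty, union_empty, singleton_union] at hw
  obtain ⟨a, b, hab⟩ := Submodule.mem_span_pair.mp hw
  exact ⟨a, b, hab.symm⟩

theorem exists_dual_eq_eq (hE : Module.finrank ℝ E = 2) {u v : E}
    (h : LinearIndependent ℝ ![u, v]) (s t : ℝ) : ∃ f : E →L[ℝ] ℝ, f u = s ∧ f v = t := by
  have : FiniteDimensional ℝ E := Module.finite_of_finrank_pos (by omega)
  let B := basisOfLinearIndependentOfCardEqFinrank h (by simp [hE])
  let f := B.constr ℝ ![s, t]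
  have h0 : f (B 0) = s := by simp [f]
  have h1 : f (B 1) = t := by simp [f]
  refine ⟨f.toContinuousLinearMap, ?_, ?_⟩
  · simpa [B] using h0
  · simpa [B] using h1

theorem Convex.add_smul_mem_of_mem_Icc {C : Set E} (hC : Convex ℝ C) {z m : E} {a b s : ℝ}
    (ha : z + a • m ∈ C) (hb : z + b • m ∈ C) (hs : s ∈ Icc a b) : z + s • m ∈ C := by
  have h : Convex ℝ (AffineMap.lineMap z (z + m) ⁻¹' C : Set ℝ) := hC.affine_preimage _
  have h' := h.ordConnected.out (x := a) (y := b)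
    (by simpa [AffineMap.lineMap_apply, add_comm] using ha)
    (by simpa [AffineMap.lineMap_apply, add_comm] using hb) hs
  simpa [AffineMap.lineMap_apply, add_comm] using h'

/-- The radial projection to the sphere of a curve that meets every ray at most once is a
circular arc. -/
theorem isCircularArc_image_radial (z : E) {e : ℝ → E} (hr : 0 < r) (he : Continuous e)
    (he0 : ∀ t ∈ Icc (0 : ℝ) 1, e t ≠ 0) (h0 : ‖e 0‖ = r) (h1 : ‖e 1‖ = r)
    (hinj : ∀ s ∈ Icc (0 : ℝ) 1, ∀ t ∈ Icc (0 : ℝ) 1, ∀ c : ℝ, 0 < c → e s = c • e t → s = t) :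
    IsCircularArc z r (z + e 0) (z + e 1) ((fun t => z + (r / ‖e t‖) • e t) '' Icc 0 1) := by
  refine ⟨?_, Or.inr ⟨_, ?_, ?_, ?_, ?_, rfl⟩⟩
  · rintro _ ⟨t, ht, rfl⟩
    have := norm_pos_iff.mpr (he0 t ht)
    simp only [mem_sphere_iff_norm, add_sub_cancel_left, norm_smul, norm_div, norm_norm,
      Real.norm_of_nonneg hr.le]
    field_simp
  · refine continuousOn_const.add (ContinuousOn.smul ?_ he.continuousOn)
    exact continuousOn_const.div he.norm.continuousOn fun t ht => norm_ne_zero_iff.mpr (he0 t ht)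
  · intro s hs t ht hst
    have h1 := norm_pos_iff.mpr (he0 t ht)
    have h2 := norm_pos_iff.mpr (he0 s hs)
    refine hinj s hs t ht (‖e s‖ / ‖e t‖) (by positivity) ?_
    have h3 : (r / ‖e s‖) • e s = (r / ‖e t‖) • e t := add_left_cancel hst
    have h4 : (‖e s‖ / r) • (r / ‖e s‖) • e s = (‖e s‖ / r) • (r / ‖e t‖) • e t := by rw [h3]
    rw [smul_smul, smul_smul] at h4
    convert h4 using 1
    · rw [div_mul_div_cancel₀ hr.ne', div_self h2.ne', one_smul]
    · congr 1
      field_simp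
  · simp [h0, div_self hr.ne']
  · simp [h1, div_self hr.ne']

theorem pair_eq_zero_of_linearIndependent {u v : E} (h : LinearIndependent ℝ ![u, v]) {a b : ℝ}
    (hab : a • u + b • v = 0) : a = 0 ∧ b = 0 :=
  LinearIndependent.pair_iff.mp h a b hab

/-- The arc is the radial projection of the chord. The ray through `y` meets the chord no later and
the arc no earlier than `y`, so `y` lies on a segment between two points of the hull. -/
theorem exists_isMinimalArc_of_mem_cone (hE : Module.finrank ℝ E = 2) (hr : 0 < r) (z : E)
    {u v y : E} (huv : LinearIndependent ℝ ![u, v]) (hu : ‖u‖ = r) (hv : ‖v‖ = r) (hy : ‖y‖ ≤ r)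
    {a b : ℝ} (ha : 0 ≤ a) (hb : 0 ≤ b) (hab : 1 ≤ a + b) (hyuv : y = a • u + b • v) :
    ∃ A, IsMinimalArc z r (z + u) (z + v) A ∧ z + y ∈ convexHull ℝ A := by
  let e : ℝ → E := fun t => (1 - t) • u + t • v
  have he : Continuous e := by fun_prop
  have he0 : ∀ t ∈ Icc (0 : ℝ) 1, e t ≠ 0 := by
    intro t _ h
    have := pair_eq_zero_of_linearIndependent huv h
    linarith
  have hele : ∀ t ∈ Icc (0 : ℝ) 1, ‖e t‖ ≤ r := by
    intro t ht
    refine norm_le_of_smul_eq (c := 1) hr.le hu.le hv.le one_pos (one_smul _ _) ?_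
    rw [abs_of_nonneg ht.1, abs_of_nonneg (by linarith [ht.2])]
    linarith
  have h0 : e 0 = u := by simp [e]
  have h1 : e 1 = v := by simp [e]
  have harc := isCircularArc_image_radial z hr he he0 (by rw [h0, hu]) (by rw [h1, hv]) (by
    intro s _ t _ c _ hst
    have h : ((1 - s) - c * (1 - t)) • u + (s - c * t) • v = 0 := by
      have : e s - c • e t = 0 := by rw [hst, sub_self]
      rw [← this]
      simp only [e]
      module
    obtain ⟨h2, h3⟩ := pair_eq_zero_of_linearIndependent huv h
    have : c = 1 := by linarith
    subst this
    linarith)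
  rw [h0, h1] at harc
  refine ⟨_, ⟨harc, ?_⟩, ?_⟩
  · obtain ⟨f, hfu, hfv⟩ := exists_dual_eq_eq hE huv (-1) (-1)
    have hfu' : (f : E →ₗ[ℝ] ℝ) u = -1 := hfu
    have hfv' : (f : E →ₗ[ℝ] ℝ) v = -1 := hfv
    refine ⟨f, ?_, ?_, ?_, ?_⟩
    · rintro h
      rw [h] at hfu'
      simp at hfu'
    · simp [hfu, hfv]
    · simp [hfu]
    · rintro _ ⟨t, ht, rfl⟩
      have hpos := norm_pos_iff.mpr (he0 t ht)
      have h2 : 1 ≤ r / ‖e t‖ := (one_le_div hpos).mpr (hele t ht)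
      have h3 : f (e t) = -1 := by
        simp only [e, map_add, map_smul, hfu, hfv, smul_eq_mul]
        ring
      simp only [ContinuousLinearMap.coe_coe, map_add, map_smul, hfu, h3, smul_eq_mul]
      linarith
  · have hσ : 0 < a + b := by linarith
    have ht : b / (a + b) ∈ Icc (0 : ℝ) 1 :=
      ⟨by positivity, (div_le_one hσ).mpr (by linarith)⟩
    have hy' : y = (a + b) • e (b / (a + b)) := by
      rw [hyuv]
      simp only [e]
      match_scalars <;> field_simp
      ring
    have hpos := norm_pos_iff.mpr (he0 _ ht)
    rw [hy']
    refine (convex_convexHull ℝ _).add_smul_mem_of_mem_Icc (a := 1) (b := r / ‖e (b / (a + b))‖)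
      ?_ (subset_convexHull ℝ _ ⟨_, ht, rfl⟩) ⟨hab, ?_⟩
    · have hu' : z + u ∈ convexHull ℝ ((fun t => z + (r / ‖e t‖) • e t) '' Icc (0 : ℝ) 1) :=
        subset_convexHull ℝ _ ⟨0, by simp, by simp [h0, hu, hr.ne']⟩
      have hv' : z + v ∈ convexHull ℝ ((fun t => z + (r / ‖e t‖) • e t) '' Icc (0 : ℝ) 1) :=
        subset_convexHull ℝ _ ⟨1, by simp, by simp [h1, hv, hr.ne']⟩
      have := convex_convexHull ℝ _ hu' hv' (sub_nonneg.mpr ht.2) ht.1 (by ring)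
      convert this using 1
      simp only [e]
      module
    · rw [le_div_iff₀ hpos]
      rw [hy', norm_smul, Real.norm_of_nonneg hσ.le] at hy
      exact hy

/-- The chord passes through the center and cannot be projected, so a parabola bulging towards `w`
replaces it. Taking `w = y` when possible makes the arc's midpoint lie on the ray through `y`;
otherwise `y` is on the diameter. -/
theorem exists_isMinimalArc_of_opposite (hE : Module.finrank ℝ E = 2) (hr : 0 < r) (z : E)
    {u y : E} (hu : ‖u‖ = r) (hy : ‖y‖ ≤ r) :
    ∃ A, IsMinimalArc z r (z + u) (z - u) A ∧ z + y ∈ convexHull ℝ A := by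
  have hu0 : u ≠ 0 := by
    rintro rfl
    simp at hu
    linarith
  obtain ⟨w, huw, hyw⟩ : ∃ w, LinearIndependent ℝ ![u, w] ∧ (w = y ∨ ∃ c : ℝ, y = c • u) := by
    by_cases h : LinearIndependent ℝ ![u, y]
    · exact ⟨y, h, Or.inl rfl⟩
    · obtain ⟨w, hw⟩ := exists_linearIndependent_pair_of_one_lt_finrank (R := ℝ) (by omega) hu0
      rw [LinearIndependent.pair_iff' hu0] at h
      push Not at h
      obtain ⟨c, hc⟩ := h
      exact ⟨w, hw, Or.inr ⟨c, hc.symm⟩⟩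
  let e : ℝ → E := fun t => (1 - 2 * t) • u + (t * (1 - t)) • w
  have he : Continuous e := by fun_prop
  have he0 : ∀ t ∈ Icc (0 : ℝ) 1, e t ≠ 0 := by
    intro t _ h
    obtain ⟨h1, h2⟩ := pair_eq_zero_of_linearIndependent huw h
    nlinarith
  have h0 : e 0 = u := by simp [e]
  have h1 : e 1 = -u := by
    simp only [e]
    module
  have hmid : e (1 / 2) = (1 / 4 : ℝ) • w := by
    simp only [e]
    module
  have harc := isCircularArc_image_radial z hr he he0 (by rw [h0, hu]) (by rw [h1, norm_neg, hu])
    (by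
    intro s hs t ht c hc hst
    have h : ((1 - 2 * s) - c * (1 - 2 * t)) • u + (s * (1 - s) - c * (t * (1 - t))) • w = 0 := by
      have : e s - c • e t = 0 := by rw [hst, sub_self]
      rw [← this]
      simp only [e]
      module
    obtain ⟨h2, h3⟩ := pair_eq_zero_of_linearIndependent huw h
    -- Compares the identity `(1 - 2 * s) ^ 2 + 4 * (s * (1 - s)) = 1` with the same identity for
    -- `t`.
    have h4 : (c - 1) * ((c + 1) * (1 - 2 * t) ^ 2 + 4 * (t * (1 - t))) = 0 := by
      have : (1 - 2 * s) ^ 2 = (c * (1 - 2 * t)) ^ 2 := by rw [sub_eq_zero.mp h2]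
      linear_combination -this - 4 * h3
    have h5 : 0 < (c + 1) * (1 - 2 * t) ^ 2 + 4 * (t * (1 - t)) := by
      nlinarith [mul_nonneg hc.le (sq_nonneg (1 - 2 * t))]
    have : c = 1 := by
      rcases mul_eq_zero.mp h4 with h | h <;> linarith
    subst this
    linarith)
  rw [h0, h1, ← sub_eq_add_neg] at harc
  refine ⟨_, ⟨harc, ?_⟩, ?_⟩
  · obtain ⟨f, hfu, hfw⟩ := exists_dual_eq_eq hE huw 0 (-1)
    have hfw' : (f : E →ₗ[ℝ] ℝ) w = -1 := hfw
    refine ⟨f, ?_, ?_, ?_, ?_⟩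
    · rintro h
      rw [h] at hfw'
      simp at hfw'
    · simp [hfu]
    · simp [hfu]
    · rintro _ ⟨t, ht, rfl⟩
      have h3 : f (e t) = -(t * (1 - t)) := by simp [e, hfu, hfw]
      have h4 : 0 ≤ r / ‖e t‖ * (t * (1 - t)) :=
        mul_nonneg (by positivity) (mul_nonneg ht.1 (by linarith [ht.2]))
      simpa [hfu, h3] using h4
  · have hu' : z + (1 : ℝ) • u ∈ convexHull ℝ ((fun t => z + (r / ‖e t‖) • e t) '' Icc (0 : ℝ) 1) :=
      subset_convexHull ℝ _ ⟨0, by simp, by simp [h0, hu, hr.ne']⟩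
    have hv' : z + (-1 : ℝ) • u ∈
        convexHull ℝ ((fun t => z + (r / ‖e t‖) • e t) '' Icc (0 : ℝ) 1) :=
      subset_convexHull ℝ _ ⟨1, by simp, by simp [h1, hu, hr.ne']⟩
    rcases hyw with rfl | ⟨c, rfl⟩
    · have hw0 : 0 < ‖w‖ := norm_pos_iff.mpr (huw.ne_zero 1)
      rw [← one_smul ℝ w]
      refine (convex_convexHull ℝ _).add_smul_mem_of_mem_Icc (a := 0) (b := r / ‖w‖) ?_ ?_
        ⟨zero_le_one, (one_le_div hw0).mpr hy⟩
      · simpa using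
          (convex_convexHull ℝ _).add_smul_mem_of_mem_Icc (s := 0) hv' hu' ⟨by simp, by simp⟩
      · refine subset_convexHull ℝ _ ⟨1 / 2, by norm_num, ?_⟩
        simp only [hmid, norm_smul, smul_smul]
        congr 2
        norm_num
        field_simp
    · refine (convex_convexHull ℝ _).add_smul_mem_of_mem_Icc hv' hu' (abs_le.mp ?_)
      rw [norm_smul, hu, Real.norm_eq_abs] at hy
      nlinarith

/-- Two points of a circle are independent as vectors from the center, or equal, or opposite. -/
theorem linearIndependent_or_eq_or_eq_neg (hr : 0 < r) {u v : E} (hu : ‖u‖ = r) (hv : ‖v‖ = r) :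
    LinearIndependent ℝ ![u, v] ∨ v = u ∨ v = -u := by
  by_cases h : LinearIndependent ℝ ![u, v]
  · exact Or.inl h
  have hu0 : u ≠ 0 := by
    rintro rfl
    simp at hu
    linarith
  rw [LinearIndependent.pair_iff' hu0] at h
  push Not at h
  obtain ⟨c, rfl⟩ := h
  rw [norm_smul, hu, Real.norm_eq_abs] at hv
  have hc : |c| = 1 := by nlinarith
  rcases (abs_eq zero_le_one).mp hc with rfl | rfl
  · simp
  · simp

theorem exists_isMinimalArc (hE : Module.finrank ℝ E = 2) (hr : 0 < r) {z p q : E}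
    (hp : ‖p - z‖ = r) (hq : ‖q - z‖ = r) (hpq : p ≠ q) : ∃ A, IsMinimalArc z r p q A := by
  have hzp : z + (p - z) = p := by abel
  rcases linearIndependent_or_eq_or_eq_neg hr hp hq with h | h | h
  · obtain ⟨A, hA, -⟩ := exists_isMinimalArc_of_mem_cone hE hr z h hp hq hp.le zero_le_one le_rfl
      (by simp) (by simp : p - z = (1 : ℝ) • (p - z) + (0 : ℝ) • (q - z))
    rw [hzp, show z + (q - z) = q by abel] at hA
    exact ⟨A, hA⟩
  · exact absurd (sub_left_injective h).symm hpq
  · obtain ⟨A, hA, -⟩ := exists_isMinimalArc_of_opposite hE hr z hp hp.le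
    rw [hzp, show z - (p - z) = z + -(p - z) by abel, ← h, show z + (q - z) = q by abel] at hA
    exact ⟨A, hA⟩

end Plane

/-! ### Minimal arcs lie in the ball hull -/

section MinimalArc

theorem mem_ballHull {E : Type*} [NormedAddCommGroup E] {K : Set E} {r : ℝ} {y : E} :
    y ∈ ballHull K r ↔ ∀ z, K ⊆ closedBall z r → ‖y - z‖ ≤ r := by
  simp [ballHull, dist_eq_norm]

variable {E : Type*} [NormedAddCommGroup E] [NormedSpace ℝ E] {r : ℝ}

/-- A sphere point beyond the chord but outside the cone forces `a + b = 1`. Then `u` lies between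
`v` and `w`, so a functional norming `u` also norms `v`: the sphere is flat there. -/
theorem exists_dual_eq_of_collinear_sphere (hr : 0 < r) {u v w : E} {a b : ℝ} (hu : ‖u‖ = r)
    (hv : ‖v‖ = r) (hw : ‖w‖ = r) (hwuv : w = a • u + b • v) (hb : b < 0) (hab : 1 ≤ a + b) :
    ∃ g : E →L[ℝ] ℝ, (∀ x, g x ≤ ‖x‖) ∧ g u = r ∧ g v = r := by
  obtain ⟨g, hg, hgu⟩ := exists_dual_vector'' ℝ u
  have hgle (x : E) : g x ≤ ‖x‖ :=
    (le_abs_self _).trans <| (g.le_opNorm x).trans (mul_le_of_le_one_left (norm_nonneg x) hg)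
  have hgu : g u = r := by simpa [hu] using hgu
  have ha : a ≤ |1| + |-b| := le_of_smul_eq hr hw.le hv.le hu (by rw [hwuv]; module)
  rw [abs_one, abs_neg, abs_of_neg hb] at ha
  obtain rfl : a = 1 - b := by linarith
  have h1 := hgle w
  have h2 := hgle v
  rw [hw, hwuv] at h1
  simp only [map_add, map_smul, hgu, smul_eq_mul] at h1
  exact ⟨g, hgle, hgu, by nlinarith⟩

theorem norm_sub_lt_two_mul_of_linearIndependent [StrictConvexSpace ℝ E] {u v : E}
    (hu : ‖u‖ = r) (hv : ‖v‖ = r) (huv : LinearIndependent ℝ ![u, v]) : ‖u - v‖ < 2 * r := by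
  have h : ¬ SameRay ℝ u (-v) := by
    intro h
    have h1 : u = -v := h.eq_of_norm_eq (by rw [norm_neg, hu, hv])
    have := pair_eq_zero_of_linearIndependent huv (a := 1) (b := 1) (by rw [h1]; module)
    linarith
  have := not_sameRay_iff_norm_add_lt.mp h
  rw [norm_neg, hu, hv, ← sub_eq_add_neg] at this
  linarith

/-- The point `u` of the sphere is the midpoint of `u - z` and `u + z`, both in the ball, so they
coincide. -/
theorem eq_zero_of_norm_sub_le_of_norm_neg_sub_le [StrictConvexSpace ℝ E] {u z : E}
    (hu : ‖u‖ = r) (h1 : ‖u - z‖ ≤ r) (h2 : ‖-u - z‖ ≤ r) : z = 0 := by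
  have h2' : ‖u + z‖ ≤ r := by rwa [← norm_neg, neg_add']
  have h3 : ‖(u - z) + (u + z)‖ = 2 * r := by
    rw [show (u - z) + (u + z) = (2 : ℝ) • u by module, norm_smul, hu, Real.norm_two]
  have h4 := norm_add_le (u - z) (u + z)
  have h5 : SameRay ℝ (u - z) (u + z) := sameRay_iff_norm_add.mpr (by linarith)
  have h6 := h5.eq_of_norm_eq (by linarith)
  have h7 : (2 : ℝ) • z = 0 := by
    rw [two_smul]
    linear_combination (norm := module) (-1 : ℝ) • h6
  simpa using h7

/-- Minimal circular arcs of radius `r` are contained in all balls of radius `r` that contain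
their endpoints. -/
theorem norm_sub_le_of_mem_isMinimalArc (hE : Module.finrank ℝ E = 2) (hr : 0 < r)
    {x z p q y : E} {A : Set E} (hA : IsMinimalArc x r p q A) (hy : y ∈ A)
    (hpz : ‖p - z‖ ≤ r) (hqz : ‖q - z‖ ≤ r) (h : StrictConvexSpace ℝ E ∨ ‖p - q‖ < 2 * r) :
    ‖y - z‖ ≤ r := by
  obtain ⟨⟨hAx, hA⟩, f, hf0, hfpq, hfx, hfA⟩ := hA
  rcases hA with ⟨rfl, rfl⟩ | ⟨γ, hγc, hγi, hγ0, hγ1, rfl⟩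
  · rwa [mem_singleton_iff.mp hy]
  have hpq : p ≠ q := by
    rw [← hγ0, ← hγ1]
    exact fun h => zero_ne_one (hγi (by simp) (by simp) h)
  have hu : ‖p - x‖ = r := mem_sphere_iff_norm.mp (hAx ⟨0, by simp, hγ0⟩)
  have hv : ‖q - x‖ = r := mem_sphere_iff_norm.mp (hAx ⟨1, by simp, hγ1⟩)
  have hw : ‖y - x‖ = r := mem_sphere_iff_norm.mp (hAx hy)
  have hsub (a : E) : a - x - (z - x) = a - z := by abel
  rcases linearIndependent_or_eq_or_eq_neg hr hu hv with huv | huv | huv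
  · have hlt : ‖(p - x) - (q - x)‖ < 2 * r := by
      rcases h with h | h
      · exact norm_sub_lt_two_mul_of_linearIndependent hu hv huv
      · simpa using h
    have hfuv : f (q - x) = f (p - x) := by simp [hfpq]
    have hfu : f (p - x) < 0 := by
      rcases (sub_nonpos.mpr hfx).lt_or_eq with h | h
      · simpa using h
      · rw [← map_sub] at h
        refine absurd (LinearMap.ext fun d => ?_) hf0
        obtain ⟨a, b, rfl⟩ := exists_eq_smul_add_smul hE huv d
        rw [map_add, map_smul, map_smul, hfuv, h]
        simp
    have hsum : ∀ d ∈ γ '' Icc 0 1, ∀ a b : ℝ, d - x = a • (p - x) + b • (q - x) →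
        1 ≤ a + b := by
      intro d hd a b hdab
      have h1 := hfA d hd
      have h2 : f (d - x) ≤ f (p - x) := by simpa using h1
      rw [hdab, map_add, map_smul, map_smul, hfuv, smul_eq_mul, smul_eq_mul] at h2
      nlinarith
    -- On a flat piece the whole arc lies on the line through `p` and `q`. Being injective it is
    -- monotone along this line, so it stays between its endpoints.
    have hflat : ∀ g : E →L[ℝ] ℝ, (∀ x, g x ≤ ‖x‖) → g (p - x) = r → g (q - x) = r →
        ∀ a b : ℝ, y - x = a • (p - x) + b • (q - x) → 0 ≤ a ∧ 0 ≤ b := by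
      intro g hg hgu hgv a b hab
      have hline : ∀ d ∈ γ '' Icc 0 1, ∀ a b : ℝ, d - x = a • (p - x) + b • (q - x) →
          a + b = 1 := by
        intro d hd a b hdab
        have h1 := hsum d hd a b hdab
        have h2 := hg (d - x)
        rw [mem_sphere_iff_norm.mp (hAx hd), hdab] at h2
        simp only [map_add, map_smul, hgu, hgv, smul_eq_mul] at h2
        nlinarith
      obtain ⟨k, hku, hkv⟩ := exists_dual_eq_eq hE huv 1 0
      have hkc : ContinuousOn (fun t => k (γ t - x)) (Icc 0 1) :=
        k.continuous.comp_continuousOn (hγc.sub continuousOn_const)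
      have hki : InjOn (fun t => k (γ t - x)) (Icc 0 1) := by
        intro s hs t ht hst
        apply hγi hs ht
        obtain ⟨a, b, hab⟩ := exists_eq_smul_add_smul hE huv (γ s - x)
        obtain ⟨a', b', hab'⟩ := exists_eq_smul_add_smul hE huv (γ t - x)
        have h1 := hline _ ⟨s, hs, rfl⟩ a b hab
        have h2 := hline _ ⟨t, ht, rfl⟩ a' b' hab'
        simp only [hab, hab', map_add, map_smul, hku, hkv, smul_eq_mul, mul_one, mul_zero,
          add_zero] at hst
        obtain rfl : b = b' := by linarith
        rw [hst, ← hab'] at hab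
        exact sub_left_injective hab
      have hanti := hkc.strictAntiOn_of_injOn_Icc zero_le_one (by simp [hγ0, hγ1, hku, hkv]) hki
      obtain ⟨t, ht, rfl⟩ := hy
      have h0 := hanti.antitoneOn (by simp) ht ht.1
      have h1 := hanti.antitoneOn ht (by simp) ht.2
      simp only [hγ0, hγ1, hab, map_add, map_smul, hku, hkv, smul_eq_mul, mul_one, mul_zero,
          add_zero] at h0 h1
      have := hline _ ⟨t, ht, rfl⟩ a b hab
      exact ⟨h1, by linarith⟩
    obtain ⟨a, b, hab⟩ := exists_eq_smul_add_smul hE huv (y - x)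
    have hab1 := hsum y hy a b hab
    obtain ⟨ha, hb⟩ : 0 ≤ a ∧ 0 ≤ b := by
      by_contra hneg
      rw [not_and_or, not_le, not_le] at hneg
      rcases hneg with ha | hb
      · obtain ⟨g, hg, hgv, hgu⟩ := exists_dual_eq_of_collinear_sphere hr hv hu hw
          (hab.trans (add_comm _ _)) ha (by linarith)
        exact absurd (hflat g hg hgu hgv a b hab).1 (not_le.mpr ha)
      · obtain ⟨g, hg, hgu, hgv⟩ := exists_dual_eq_of_collinear_sphere hr hu hv hw hab hb hab1
        exact absurd (hflat g hg hgu hgv a b hab).2 (not_le.mpr hb)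
    obtain ⟨c, d, hz⟩ := exists_eq_smul_add_smul hE huv (z - x)
    have := norm_sub_le_of_mem_cone hr hu hv hw hlt ha hb hab hz (by rwa [hsub]) (by rwa [hsub])
    rwa [hsub] at this
  · exact absurd (sub_left_injective huv).symm hpq
  · rcases h with h | h
    · have : z - x = 0 := eq_zero_of_norm_sub_le_of_norm_neg_sub_le hu (by rwa [hsub])
        (by rwa [← huv, hsub])
      rw [← hsub, this, sub_zero, hw]
    · have h1 : p - q = (2 : ℝ) • (p - x) := by
        rw [two_smul]
        linear_combination (norm := module) (-1 : ℝ) • huv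
      rw [h1, norm_smul, hu, Real.norm_two] at h
      exact absurd h (lt_irrefl _)

theorem convex_ballHull (K : Set E) (r : ℝ) : Convex ℝ (ballHull K r) :=
  convex_iInter₂ fun x _ => convex_closedBall x r

theorem minimalArcUnion_subset_ballHull (hE : Module.finrank ℝ E = 2) (hr : 0 < r) {K : Set E}
    (hfin : K.Finite) (h : StrictConvexSpace ℝ E ∨ Metric.diam K ≤ r) :
    minimalArcUnion K r ⊆ ballHull K r := by
  rintro y ⟨p, hp, q, hq, x, A, hA, hy⟩
  rw [mem_ballHull]
  intro z hz
  refine norm_sub_le_of_mem_isMinimalArc hE hr hA hy (mem_closedBall_iff_norm.mp (hz hp))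
    (mem_closedBall_iff_norm.mp (hz hq)) (h.imp_right fun h => ?_)
  have := dist_le_diam_of_mem hfin.isBounded hp hq
  rw [dist_eq_norm] at this
  linarith

theorem subset_minimalArcUnion (hE : Module.finrank ℝ E = 2) (hr : 0 < r) (K : Set E) :
    K ⊆ minimalArcUnion K r := by
  intro p hp
  have : Nontrivial E := Module.nontrivial_of_finrank_pos (R := ℝ) (by omega)
  obtain ⟨u, hu⟩ := exists_norm_eq E hr.le
  have hu0 : u ≠ 0 := by
    rintro rfl
    simp at hu
    linarith
  obtain ⟨w, hw⟩ := exists_linearIndependent_pair_of_one_lt_finrank (R := ℝ) (by omega) hu0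
  obtain ⟨f, hfu, -⟩ := exists_dual_eq_eq hE hw 1 0
  have hfu' : (f : E →ₗ[ℝ] ℝ) u = 1 := hfu
  refine ⟨p, hp, p, hp, p + u, {p}, ⟨⟨?_, Or.inl ⟨rfl, rfl⟩⟩, f, ?_, rfl, ?_, ?_⟩, rfl⟩
  · simp [hu]
  · intro h
    rw [h] at hfu'
    simp at hfu'
  · simp [hfu]
  · simp

end MinimalArc

/-! ### Extremal centers and reduction to two points -/

section Minimizer

/-- The infimum is attained: the center sets for the radii `r + 1 / (n + 1)` are nested, nonempty
and compact. -/
theorem exists_subset_closedBall_of_circumradius_le {E : Type*} [NormedAddCommGroup E]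
    [ProperSpace E] {K : Set E} {r : ℝ} (hfin : K.Finite) (hne : K.Nonempty) (h : circumradius K ≤ r) : ∃ z, K ⊆ closedBall z r := by
  have hK (ρ : ℝ) (z : E) : z ∈ (⋂ k ∈ K, closedBall k ρ) ↔ K ⊆ closedBall z ρ := by
    simp [subset_def, dist_comm]
  obtain ⟨k, hk⟩ := hne
  have hne' : {ρ : ℝ | 0 ≤ ρ ∧ ∃ x : E, K ⊆ closedBall x ρ}.Nonempty := by
    obtain ⟨R, hR⟩ := (isBounded_iff_subset_closedBall k).mp hfin.isBounded
    exact ⟨R, nonneg_of_mem_closedBall (hR hk), k, hR⟩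
  obtain ⟨z, hz⟩ := IsCompact.nonempty_iInter_of_sequence_nonempty_isCompact_isClosed
    (fun n : ℕ => ⋂ k ∈ K, closedBall k (r + 1 / ((n : ℝ) + 1)))
    (fun n => iInter₂_mono fun k _ => closedBall_subset_closedBall <| by
      gcongr
      simp)
    (fun n => by
      obtain ⟨ρ, ⟨-, x, hx⟩, hρ⟩ := exists_lt_of_csInf_lt hne'
        (h.trans_lt (lt_add_of_pos_right r (Nat.one_div_pos_of_nat (n := n))))
      exact ⟨x, (hK _ _).mpr (hx.trans (closedBall_subset_closedBall hρ.le))⟩)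
    ((isCompact_closedBall k _).of_isClosed_subset
      (isClosed_biInter fun _ _ => isClosed_closedBall) (biInter_subset_of_mem hk))
    (fun n => isClosed_biInter fun _ _ => isClosed_closedBall)
  refine ⟨z, fun k hk => ?_⟩
  rw [mem_closedBall]
  refine le_of_forall_pos_le_add fun ε hε => ?_
  obtain ⟨n, hn⟩ := exists_nat_one_div_lt hε
  have := (hK _ _).mp (mem_iInter.mp hz n) hk
  rw [mem_closedBall] at this
  linarith

variable {E : Type*} [NormedAddCommGroup E] [NormedSpace ℝ E] {r : ℝ}

theorem le_norm_of_forall_le {f : E →L[ℝ] ℝ} (hf : f ≠ 0) {m : E} (hr : 0 < r)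
    (h : ∀ b, ‖b‖ ≤ r → f b ≤ f m) : r ≤ ‖m‖ := by
  by_contra! hm
  apply hf
  have hm0 : f m ≤ 0 := by
    rcases (norm_nonneg m).eq_or_lt with h0 | h0
    · rw [norm_eq_zero.mp h0.symm, map_zero]
    · have h1 := h ((r / ‖m‖) • m) (by
        rw [norm_smul, norm_div, norm_norm, Real.norm_of_nonneg hr.le, div_mul_cancel₀ _ h0.ne'])
      rw [map_smul, smul_eq_mul] at h1
      have : 1 < r / ‖m‖ := (one_lt_div h0).mpr hm
      nlinarith
  have key (b : E) : f b ≤ 0 := by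
    have h1 := h ((r / (‖b‖ + 1)) • b) (by
      rw [norm_smul, Real.norm_of_nonneg (by positivity), div_mul_eq_mul_div,
        div_le_iff₀ (by positivity)]
      nlinarith [norm_nonneg b])
    rw [map_smul, smul_eq_mul] at h1
    have : 0 < r / (‖b‖ + 1) := by positivity
    nlinarith
  ext b
  have h1 := key b
  have h2 := key (-b)
  rw [map_neg] at h2
  simp only [zero_apply]
  linarith

/-- A minimizer of `f` over an intersection of two balls that is an interior point of the first
ball is a minimizer over the second ball. -/
theorem forall_le_of_norm_lt {f : E →L[ℝ] ℝ} {z p q : E} (hp : ‖z - p‖ < r) (hq : ‖z - q‖ ≤ r)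
    (h : ∀ d, ‖d - p‖ ≤ r → ‖d - q‖ ≤ r → f z ≤ f d) {d : E} (hd : ‖d - q‖ ≤ r) : f z ≤ f d := by
  obtain ⟨ε, hε, hε1, hεd⟩ : ∃ ε : ℝ, 0 < ε ∧ ε ≤ 1 ∧ ε * ‖d - z‖ ≤ r - ‖z - p‖ := by
    have h0 : 0 < (r - ‖z - p‖) / (‖d - z‖ + 1) :=
      div_pos (by linarith) (by positivity)
    refine ⟨min 1 ((r - ‖z - p‖) / (‖d - z‖ + 1)), lt_min one_pos h0, min_le_left _ _, ?_⟩
    calc _ ≤ (r - ‖z - p‖) / (‖d - z‖ + 1) * (‖d - z‖ + 1) := by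
          gcongr
          · exact min_le_right _ _
          · linarith
      _ = _ := div_mul_cancel₀ _ (by positivity)
  have h1 : f z ≤ f (z + ε • (d - z)) := by
    apply h
    · calc ‖z + ε • (d - z) - p‖ = ‖(z - p) + ε • (d - z)‖ := by congr 1; abel
        _ ≤ ‖z - p‖ + ‖ε • (d - z)‖ := norm_add_le _ _
        _ = ‖z - p‖ + ε * ‖d - z‖ := by rw [norm_smul, Real.norm_of_nonneg hε.le]
        _ ≤ r := by linarith
    · have := (convex_closedBall q r).add_smul_sub_mem (mem_closedBall_iff_norm.mpr hq)
        (mem_closedBall_iff_norm.mpr hd) ⟨hε.le, hε1⟩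
      exact mem_closedBall_iff_norm.mp this
  simp only [map_add, map_smul, map_sub, smul_eq_mul] at h1
  nlinarith

/-- Minimizing a linear functional over the centers of the balls of radius `r` that contain `K`
amounts to doing so for some two points of `K`. -/
theorem exists_minimizer_pair (hE : Module.finrank ℝ E = 2) {K : Set E} (hfin : K.Finite)
    (hK : K.Nontrivial) (hZ : ∃ z, K ⊆ closedBall z r) (f : E →L[ℝ] ℝ) :
    ∃ z, K ⊆ closedBall z r ∧ ∃ p ∈ K, ∃ q ∈ K, p ≠ q ∧
      ∀ d, ‖d - p‖ ≤ r → ‖d - q‖ ≤ r → f z ≤ f d := by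
  classical
  have : FiniteDimensional ℝ E := Module.finite_of_finrank_pos (by omega)
  have : ProperSpace E := FiniteDimensional.proper ℝ E
  have hZK (z : E) : z ∈ (⋂ k ∈ K, closedBall k r) ↔ K ⊆ closedBall z r := by
    simp [subset_def, dist_comm]
  obtain ⟨k, hk⟩ := hK.nonempty
  have hcomp : IsCompact (⋂ k ∈ K, closedBall k r) :=
    (isCompact_closedBall k r).of_isClosed_subset
      (isClosed_biInter fun _ _ => isClosed_closedBall) (biInter_subset_of_mem hk)
  obtain ⟨z, hz, hmin⟩ := hcomp.exists_isMinOn (hZ.imp fun z hz => (hZK z).mpr hz)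
    f.continuous.continuousOn
  refine ⟨z, (hZK z).mp hz, ?_⟩
  by_contra! hcon
  -- If every pair in `K` admitted a smaller value than `f z`, any three of the balls and this open
  -- half-plane would meet. By Helly all of them would meet, contradicting minimality of `z`.
  let F : Option E → Set E := fun o => o.elim {d | f d < f z} fun k => closedBall k r
  obtain ⟨d, hd⟩ := Convex.helly_theorem' (𝕜 := ℝ) (F := F) (s := hfin.toFinset.insertNone)
    (by
      rintro (_ | k) -
      · exact convex_halfSpace_lt f.isLinear _
      · exact convex_closedBall k r)
    (by
      intro I hI hcard
      rw [hE] at hcard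
      have hIK (k : E) (hk : some k ∈ I) : k ∈ K := by
        simpa using hI hk
      by_cases hnone : none ∈ I
      · obtain ⟨p, hp, q, hq, hpq, hsub⟩ : ∃ p ∈ K, ∃ q ∈ K, p ≠ q ∧
            ∀ k, some k ∈ I → k = p ∨ k = q := by
          have hJ : (Finset.eraseNone I).card ≤ 2 := by
            have : (Finset.eraseNone I).card + 1 = I.card := by
              rw [← Finset.card_insertNone, Finset.insertNone_eraseNone,
                Finset.insert_eq_of_mem hnone]
            omega
          have hJK : ((Finset.eraseNone I : Finset E) : Set E) ⊆ K := fun k hk =>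
            hIK k (by simpa using hk)
          obtain ⟨T, hJT, hTK, hT⟩ := Finset.exists_subsuperset_card_eq (s := Finset.eraseNone I)
            (t := hfin.toFinset) (n := 2) (fun k hk => by simpa using hJK hk) hJ
            (Finset.one_lt_card.mpr (by
              obtain ⟨a, ha, b, hb, hab⟩ := hK
              exact ⟨a, by simpa using ha, b, by simpa using hb, hab⟩))
          obtain ⟨p, q, hpq, rfl⟩ := Finset.card_eq_two.mp hT
          exact ⟨p, by simpa using hTK (by simp : p ∈ _), q, by simpa using hTK (by simp : q ∈ _),
            hpq, fun k hk => by simpa using hJT (by simpa using hk : k ∈ _)⟩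
        obtain ⟨d, hdp, hdq, hdz⟩ := hcon p hp q hq hpq
        refine ⟨d, mem_iInter₂.mpr ?_⟩
        rintro (_ | k) hk
        · exact hdz
        · rcases hsub k hk with rfl | rfl
          · exact mem_closedBall_iff_norm.mpr hdp
          · exact mem_closedBall_iff_norm.mpr hdq
      · refine ⟨z, mem_iInter₂.mpr ?_⟩
        rintro (_ | k) hk
        · exact absurd hk hnone
        · exact mem_iInter₂.mp hz k (hIK k hk))
  rw [mem_iInter₂] at hd
  have hdz : f d < f z := hd none (by simp)
  exact absurd (hmin (mem_iInter₂.mpr fun k hk => hd (some k) (by simpa using hk)))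
    (not_le.mpr hdz)

/-- If one constraint is slack, `z` minimizes `f` over the ball about the other point alone, which
then is a highest point of the ball about `z`. -/
theorem norm_sub_eq_or_exists_forall_le {f : E →L[ℝ] ℝ} {z p q : E} (hp : ‖p - z‖ ≤ r)
    (hq : ‖q - z‖ ≤ r) (h : ∀ d, ‖d - p‖ ≤ r → ‖d - q‖ ≤ r → f z ≤ f d) :
    (‖p - z‖ = r ∧ ‖q - z‖ = r) ∨
      ((∀ b, ‖b‖ ≤ r → f b ≤ f (p - z)) ∨ ∀ b, ‖b‖ ≤ r → f b ≤ f (q - z)) := by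
  have key : ∀ {p q : E}, ‖p - z‖ < r → ‖q - z‖ ≤ r →
      (∀ d, ‖d - p‖ ≤ r → ‖d - q‖ ≤ r → f z ≤ f d) → ∀ b, ‖b‖ ≤ r → f b ≤ f (q - z) := by
    intro p q hp hq h b hb
    have := forall_le_of_norm_lt (by rwa [norm_sub_rev]) (by rwa [norm_sub_rev]) h (d := q - b)
      (by simpa using hb)
    rw [map_sub] at this ⊢
    linarith
  rcases hp.lt_or_eq with hp' | hp'
  · exact Or.inr (Or.inr (key hp' hq h))
  rcases hq.lt_or_eq with hq' | hq'
  · exact Or.inr (Or.inl (key hq' hp fun d h1 h2 => h d h2 h1))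
  exact Or.inl ⟨hp', hq'⟩

theorem exists_isMinimalArc_of_minimizer (hE : Module.finrank ℝ E = 2) (hr : 0 < r)
    {f : E →L[ℝ] ℝ} {z p q y : E} (hpq : p ≠ q) (hp : ‖p - z‖ = r) (hq : ‖q - z‖ = r)
    (hy : ‖y - z‖ ≤ r) (hfp : f p < f y) (hfq : f q < f y)
    (h : ∀ d, ‖d - p‖ ≤ r → ‖d - q‖ ≤ r → f z ≤ f d) :
    ∃ A, IsMinimalArc z r p q A ∧ y ∈ convexHull ℝ A := by
  have hz (a : E) : z + (a - z) = a := by abel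
  rcases linearIndependent_or_eq_or_eq_neg hr hp hq with huv | huv | huv
  · obtain ⟨a, b, hab⟩ := exists_eq_smul_add_smul hE huv (y - z)
    obtain ⟨ha, hb, hab1⟩ := coeff_nonneg_of_forall_nonneg f hr hp hq hy (by simpa using hfp)
      (by simpa using hfq) (fun d hd1 hd2 => by
        have := h (z + d) (by rwa [show z + d - p = d - (p - z) by abel])
          (by rwa [show z + d - q = d - (q - z) by abel])
        simpa using this) hab
    simpa only [hz] using exists_isMinimalArc_of_mem_cone hE hr z huv hp hq hy ha hb hab1 hab
  · exact absurd (sub_left_injective huv).symm hpq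
  · simpa only [hz, sub_eq_add_neg z, ← huv] using exists_isMinimalArc_of_opposite hE hr z hp hy

end Minimizer

/-! ### The inclusions for the ball hull -/

section BallHull

variable {E : Type*} [NormedAddCommGroup E] [NormedSpace ℝ E] {r : ℝ}

theorem carriesArc_of_norm_eq (hE : Module.finrank ℝ E = 2) (hr : 0 < r) {K : Set E} {z p q : E}
    (hpK : p ∈ K) (hqK : q ∈ K) (hpq : p ≠ q) (hp : ‖p - z‖ = r) (hq : ‖q - z‖ = r) :
    CarriesArc K z r := by
  obtain ⟨A, hA⟩ := exists_isMinimalArc hE hr hp hq hpq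
  exact ⟨p, hpK, q, hqK, fun _ => hpq, A, hA.1⟩

/-- A functional separating `y` from the finite set `K` can be rotated until it attains its maximum
over `K` at two points, unless `y` and `K` are collinear. -/
theorem exists_two_maximizers_or_collinear (hE : Module.finrank ℝ E = 2) {K : Set E}
    (hfin : K.Finite) (hK : K.Nontrivial) {f : E →L[ℝ] ℝ} {y : E} (hf : ∀ k ∈ K, f k < f y) :
    (∃ g : E →L[ℝ] ℝ, (∀ k ∈ K, g k < g y) ∧
      ∃ p ∈ K, ∃ q ∈ K, p ≠ q ∧ ∀ k ∈ K, g k ≤ g p ∧ g k ≤ g q) ∨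
    ∃ p ∈ K, (∀ k ∈ K, f k ≤ f p) ∧ ∀ k ∈ K, ∃ c : ℝ, k - p = c • (y - p) := by
  obtain ⟨p, hp, hmax⟩ := exists_max_image K f hfin hK.nonempty
  have hv : y - p ≠ 0 := by
    intro h
    have := hf p hp
    rw [sub_eq_zero.mp h] at this
    exact lt_irrefl _ this
  obtain ⟨w, hw⟩ := exists_linearIndependent_pair_of_one_lt_finrank (R := ℝ) (by omega) hv
  by_cases hcol : ∀ k ∈ K, ∃ c : ℝ, k - p = c • (y - p)
  · exact Or.inr ⟨p, hp, hmax, hcol⟩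
  left
  push Not at hcol
  obtain ⟨k₀, hk₀, hk₀c⟩ := hcol
  -- Adding multiples of `g` rotates the level line without changing `f y - f p`.
  obtain ⟨g, hgv, hgk₀⟩ : ∃ g : E →L[ℝ] ℝ, g y = g p ∧ g p < g k₀ := by
    obtain ⟨a, b, hab⟩ := exists_eq_smul_add_smul hE hw (k₀ - p)
    have hb : b ≠ 0 := by
      rintro rfl
      exact hk₀c a (by simpa using hab)
    obtain ⟨g, hg1, hg2⟩ := exists_dual_eq_eq hE hw 0 b
    refine ⟨g, by simpa [sub_eq_zero] using hg1, ?_⟩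
    have h1 : g (k₀ - p) = b * b := by rw [hab, map_add, map_smul, map_smul, hg1, hg2]; simp
    have h2 : 0 < b * b := mul_self_pos.mpr hb
    rw [map_sub] at h1
    linarith
  -- The least ratio is the first parameter at which another point of `K` ties with `p`.
  obtain ⟨q, ⟨hqK, hq⟩, hqmin⟩ := exists_min_image {k ∈ K | g p < g k}
    (fun k => (f p - f k) / (g k - g p)) (hfin.sep _) ⟨k₀, hk₀, hgk₀⟩
  set s := (f p - f q) / (g q - g p)
  have hs0 : 0 ≤ s := div_nonneg (by linarith [hmax q hqK]) (by linarith)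
  have hsq : s * (g q - g p) = f p - f q := div_mul_cancel₀ _ (by linarith)
  have hle : ∀ k ∈ K, (f + s • g) k ≤ (f + s • g) p := by
    intro k hk
    simp only [add_apply, smul_apply, smul_eq_mul]
    rcases le_or_gt (g k) (g p) with h | h
    · nlinarith [hmax k hk]
    · have := (le_div_iff₀ (by linarith)).mp (hqmin k ⟨hk, h⟩)
      linarith
  have hpq : (f + s • g) p = (f + s • g) q := by
    simp only [add_apply, smul_apply, smul_eq_mul]
    linarith
  refine ⟨f + s • g, fun k hk => (hle k hk).trans_lt ?_, p, hp, q, hqK, ?_,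
    fun k hk => ⟨hle k hk, hpq ▸ hle k hk⟩⟩
  · simp only [add_apply, smul_apply, smul_eq_mul]
    rw [hgv]
    linarith [hf p hp]
  · rintro rfl
    exact lt_irrefl _ hq

/-- If `K` lies on a line and `y` is a point of this line beyond `K`, then some circle of
radius `r` through two points of `K` encloses `K` but not `y`. -/
theorem exists_carriesArc_of_collinear (hE : Module.finrank ℝ E = 2) (hr : 0 < r) {K : Set E}
    (hfin : K.Finite) (hK : K.Nontrivial) (hZ : ∃ z, K ⊆ closedBall z r) {f : E →L[ℝ] ℝ} {y p : E}
    (hp : p ∈ K) (hf : ∀ k ∈ K, f k < f y) (hmax : ∀ k ∈ K, f k ≤ f p)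
    (hcol : ∀ k ∈ K, ∃ c : ℝ, k - p = c • (y - p)) :
    ∃ z, K ⊆ closedBall z r ∧ CarriesArc K z r ∧ r < ‖y - z‖ := by
  have : FiniteDimensional ℝ E := Module.finite_of_finrank_pos (by omega)
  have : ProperSpace E := FiniteDimensional.proper ℝ E
  have hfv : 0 < f (y - p) := by
    rw [map_sub]
    linarith [hf p hp]
  have hv : y - p ≠ 0 := by
    intro h
    rw [h, map_zero] at hfv
    exact lt_irrefl _ hfv
  obtain ⟨w, hw⟩ := exists_linearIndependent_pair_of_one_lt_finrank (R := ℝ) (by omega) hv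
  obtain ⟨g, hgv, hgw⟩ := exists_dual_eq_eq hE hw 0 1
  have hg0 : g ≠ 0 := by
    rintro rfl
    simp at hgw
  choose! c hc using hcol
  have hfc : ∀ k ∈ K, f k = f p + c k * f (y - p) := by
    intro k hk
    have := congrArg f (hc k hk)
    rw [map_sub, map_smul, smul_eq_mul] at this
    linarith
  obtain ⟨q, hq, hmin⟩ := exists_min_image K c hfin hK.nonempty
  have hc0 : ∀ k ∈ K, c k ≤ 0 := by
    intro k hk
    have := hfc k hk
    nlinarith [hmax k hk]
  have hcq : c q < 0 := by
    obtain ⟨k, hk, hkp⟩ := hK.exists_ne p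
    have hck : c k ≠ 0 := by
      intro h
      have := hc k hk
      rw [h, zero_smul, sub_eq_zero] at this
      exact hkp this
    exact (hmin k hk).trans_lt ((hc0 k hk).lt_of_ne hck)
  have hqp : q ≠ p := by
    rintro rfl
    have := hc q hq
    rw [sub_self, eq_comm, smul_eq_zero] at this
    exact this.elim hcq.ne hv
  have hqeq : q = p + c q • (y - p) := by rw [← hc q hq]; abel
  -- `K` lies on the segment from `q` to `p`, so only these two points constrain the center. It is
  -- chosen lexicographically: `g`, constant on the line, is maximal, then `f` minimal.
  let Z : Set E := closedBall p r ∩ closedBall q r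
  have hZK : ∀ z ∈ Z, K ⊆ closedBall z r := by
    rintro z ⟨hzp, hzq⟩ k hk
    rw [show k = p + c k • (y - p) by rw [← hc k hk]; abel]
    refine (convex_closedBall z r).add_smul_mem_of_mem_Icc (a := c q) (b := 0) ?_ ?_
      ⟨hmin k hk, hc0 k hk⟩
    · rwa [← hqeq, mem_closedBall_comm]
    · rwa [zero_smul, add_zero, mem_closedBall_comm]
  have hZcomp : IsCompact Z := (isCompact_closedBall p r).inter_right isClosed_closedBall
  obtain ⟨z₁, hz₁, hz₁max⟩ := hZcomp.exists_isMaxOn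
    (hZ.imp fun z hz => ⟨mem_closedBall_comm.mp (hz hp), mem_closedBall_comm.mp (hz hq)⟩)
    g.continuous.continuousOn
  obtain ⟨z, ⟨hz, hgz⟩, hzmin⟩ := (hZcomp.inter_right
    (isClosed_eq g.continuous continuous_const : IsClosed {z | g z = g z₁})).exists_isMinOn
    ⟨z₁, hz₁, rfl⟩ f.continuous.continuousOn
  have hgz : g z = g z₁ := hgz
  -- A shift back by at most `-c q` keeps `z` in the ball about `q`, since the shift by `q - p`
  -- turns `z - q` into `z - p`. Minimality of `f z` thus forces it out of the ball about `p`; `δ =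
  -- 1` gives `r < ‖y - z‖`.
  have hback : ∀ δ : ℝ, 0 < δ → z + (-δ) • (y - p) ∉ closedBall p r := by
    intro δ hδ hmem
    have hε : 0 < min δ (-c q) := lt_min hδ (by linarith)
    have h1 : z + (-min δ (-c q)) • (y - p) ∈ closedBall p r :=
      (convex_closedBall p r).add_smul_mem_of_mem_Icc (b := 0) hmem (by simpa using hz.1)
        ⟨by simp, by linarith⟩
    have h2 : z + (-min δ (-c q)) • (y - p) ∈ closedBall q r := by
      refine (convex_closedBall q r).add_smul_mem_of_mem_Icc (a := c q) (b := 0) ?_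
        (by simpa using hz.2) ⟨by linarith [min_le_right δ (-c q)], by linarith⟩
      have := hz.1
      rw [mem_closedBall_iff_norm] at this ⊢
      rwa [← hc q hq, show z + (q - p) - q = z - p by abel]
    have h3 : f z ≤ f (z + (-min δ (-c q)) • (y - p)) :=
      hzmin ⟨⟨h1, h2⟩, by simp only [mem_ofPred_eq, map_add, map_smul, hgv, hgz]; simp⟩
    rw [map_add, map_smul, smul_eq_mul] at h3
    nlinarith
  have hgmin : ∀ d, ‖d - p‖ ≤ r → ‖d - q‖ ≤ r → (-g) z ≤ (-g) d := by
    intro d h1 h2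
    have := hz₁max (show d ∈ Z from ⟨mem_closedBall_iff_norm.mpr h1, mem_closedBall_iff_norm.mpr h2⟩)
    simpa [hgz] using this
  have hzK := hZK z hz
  have hpz := mem_closedBall_iff_norm.mp (hzK hp)
  have hqz := mem_closedBall_iff_norm.mp (hzK hq)
  have hgpq : g q = g p := by rw [hqeq, map_add, map_smul, hgv]; simp
  have hpqz : ‖p - z‖ = r ∧ ‖q - z‖ = r := by
    rcases norm_sub_eq_or_exists_forall_le hpz hqz hgmin with h | h
    · exact h
    · have h' : ∀ b, ‖b‖ ≤ r → (-g) b ≤ (-g) (p - z) ∧ (-g) b ≤ (-g) (q - z) := by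
        have : (-g) (p - z) = (-g) (q - z) := by simp [hgpq]
        intro b hb
        rcases h with h | h
        · exact ⟨h b hb, this ▸ h b hb⟩
        · exact ⟨this ▸ h b hb, h b hb⟩
      exact ⟨hpz.antisymm (le_norm_of_forall_le (neg_ne_zero.mpr hg0) hr fun b hb => (h' b hb).1),
        hqz.antisymm (le_norm_of_forall_le (neg_ne_zero.mpr hg0) hr fun b hb => (h' b hb).2)⟩
  refine ⟨z, hzK, carriesArc_of_norm_eq hE hr hp hq hqp.symm hpqz.1 hpqz.2, ?_⟩
  have h1 := hback 1 one_pos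
  rw [mem_closedBall_iff_norm, not_le, show z + (-1 : ℝ) • (y - p) - p = -(y - z) by module,
    norm_neg] at h1
  exact h1

theorem exists_dual_lt_of_notMem_convexHull {K : Set E} (hfin : K.Finite) {y : E}
    (hy : y ∉ convexHull ℝ K) : ∃ f : E →L[ℝ] ℝ, ∀ k ∈ K, f k < f y := by
  obtain ⟨f, u, hfu, huy⟩ := geometric_hahn_banach_closed_point (convex_convexHull ℝ K)
    (hfin.isClosed_convexHull ℝ) hy
  exact ⟨f, fun k hk => (hfu k (subset_convexHull ℝ K hk)).trans huy⟩

theorem convexHull_subset_convexHull_minimalArcUnion {K A : Set E} {z p q : E} (hp : p ∈ K)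
    (hq : q ∈ K) (hA : IsMinimalArc z r p q A) :
    convexHull ℝ A ⊆ convexHull ℝ (minimalArcUnion K r) :=
  convexHull_mono fun _ hy => ⟨p, hp, q, hq, z, A, hA, hy⟩

theorem exists_norm_sub_gt {x y : E} (hr : 0 < r) (hxy : y ≠ x) :
    ∃ z, ‖x - z‖ = r ∧ r < ‖y - z‖ := by
  have hpos : 0 < ‖y - x‖ := norm_pos_iff.mpr (sub_ne_zero.mpr hxy)
  refine ⟨x - (r / ‖y - x‖) • (y - x), ?_, ?_⟩
  · rw [sub_sub_cancel, norm_smul, norm_div, norm_norm, Real.norm_of_nonneg hr.le,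
      div_mul_cancel₀ _ hpos.ne']
  · rw [show y - (x - (r / ‖y - x‖) • (y - x)) = (1 + r / ‖y - x‖) • (y - x) by module, norm_smul,
      Real.norm_of_nonneg (by positivity), add_mul, div_mul_cancel₀ _ hpos.ne']
    linarith

theorem ballHull_subset_convexHull_minimalArcUnion (hE : Module.finrank ℝ E = 2) (hr : 0 < r)
    {K : Set E} (hfin : K.Finite) (hne : K.Nonempty) (hZ : ∃ z, K ⊆ closedBall z r) :
    ballHull K r ⊆ convexHull ℝ (minimalArcUnion K r) := by
  intro y hy
  by_cases hyK : y ∈ convexHull ℝ K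
  · exact convexHull_mono (subset_minimalArcUnion hE hr K) hyK
  rw [mem_ballHull] at hy
  rcases hne.exists_eq_singleton_or_nontrivial with ⟨x, rfl⟩ | hK
  · have hyx : y ≠ x := by simpa using hyK
    obtain ⟨z, hxz, hyz⟩ := exists_norm_sub_gt hr hyx
    exact absurd (hy z (by simpa [dist_eq_norm] using hxz.le)) (not_le.mpr hyz)
  obtain ⟨f, hf⟩ := exists_dual_lt_of_notMem_convexHull hfin hyK
  obtain ⟨z, hzK, p, hp, q, hq, hpq, hmin⟩ := exists_minimizer_pair hE hfin hK hZ f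
  have hyz := hy z hzK
  have hsphere : ‖p - z‖ = r ∧ ‖q - z‖ = r := by
    rcases norm_sub_eq_or_exists_forall_le (mem_closedBall_iff_norm.mp (hzK hp))
      (mem_closedBall_iff_norm.mp (hzK hq)) hmin with h | h | h
    · exact h
    · have := h _ hyz
      simp only [map_sub] at this
      linarith [hf p hp]
    · have := h _ hyz
      simp only [map_sub] at this
      linarith [hf q hq]
  obtain ⟨A, hA, hyA⟩ := exists_isMinimalArc_of_minimizer hE hr hpq hsphere.1 hsphere.2 hyz
    (hf p hp) (hf q hq) hmin
  exact convexHull_subset_convexHull_minimalArcUnion hp hq hA hyA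

theorem iInter_carriesArc_subset_ballHull (hE : Module.finrank ℝ E = 2) (hr : 0 < r)
    {K : Set E} (hfin : K.Finite) (hne : K.Nonempty) (hZ : ∃ z, K ⊆ closedBall z r)
    (h : StrictConvexSpace ℝ E ∨ Metric.diam K ≤ r) :
    ⋂ x ∈ {x : E | K ⊆ closedBall x r ∧ CarriesArc K x r}, closedBall x r ⊆ ballHull K r := by
  intro y hy
  have hy : ∀ z, K ⊆ closedBall z r → CarriesArc K z r → ‖y - z‖ ≤ r := fun z h1 h2 =>
    mem_closedBall_iff_norm.mp (mem_iInter₂.mp hy z ⟨h1, h2⟩)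
  have harc : minimalArcUnion K r ⊆ ballHull K r := minimalArcUnion_subset_ballHull hE hr hfin h
  have hconv : convexHull ℝ (minimalArcUnion K r) ⊆ ballHull K r :=
    convexHull_min harc (convex_ballHull K r)
  by_cases hyK : y ∈ convexHull ℝ K
  · exact hconv (convexHull_mono (subset_minimalArcUnion hE hr K) hyK)
  rcases hne.exists_eq_singleton_or_nontrivial with ⟨x, rfl⟩ | hK
  · have hyx : y ≠ x := by simpa using hyK
    obtain ⟨z, hxz, hyz⟩ := exists_norm_sub_gt hr hyx
    refine absurd (hy z (by simpa [dist_eq_norm] using hxz.le) ?_) (not_le.mpr hyz)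
    exact ⟨x, rfl, x, rfl, fun h => absurd h not_nontrivial_singleton, {x},
      by simpa [dist_eq_norm] using hxz, Or.inl ⟨rfl, rfl⟩⟩
  obtain ⟨f, hf⟩ := exists_dual_lt_of_notMem_convexHull hfin hyK
  rcases exists_two_maximizers_or_collinear hE hfin hK hf with
    ⟨g, hg, k₁, hk₁, k₂, hk₂, hk₁₂, hmax⟩ | ⟨p, hp, hmax, hcol⟩
  · obtain ⟨z, hzK, p, hp, q, hq, hpq, hmin⟩ := exists_minimizer_pair hE hfin hK hZ g
    have hpz := mem_closedBall_iff_norm.mp (hzK hp)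
    have hqz := mem_closedBall_iff_norm.mp (hzK hq)
    rcases norm_sub_eq_or_exists_forall_le hpz hqz hmin with hsphere | hk
    · have hyz := hy z hzK (carriesArc_of_norm_eq hE hr hp hq hpq hsphere.1 hsphere.2)
      obtain ⟨A, hA, hyA⟩ := exists_isMinimalArc_of_minimizer hE hr hpq hsphere.1 hsphere.2 hyz
        (hg p hp) (hg q hq) hmin
      exact hconv (convexHull_subset_convexHull_minimalArcUnion hp hq hA hyA)
    · have hg0 : g ≠ 0 := by
        rintro rfl
        simpa using hg p hp
      obtain ⟨k, hkK, hk⟩ : ∃ k ∈ K, ∀ b, ‖b‖ ≤ r → g b ≤ g (k - z) :=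
        hk.elim (fun h => ⟨p, hp, h⟩) fun h => ⟨q, hq, h⟩
      -- A nonzero functional is maximal over a ball only on its sphere. Hence both maximizers `k₁`,
      -- `k₂` lie on the circle about `z`, which therefore carries an arc.
      have hle : ∀ m ∈ K, g k ≤ g m → ‖m - z‖ = r := by
        intro m hm hkm
        refine (mem_closedBall_iff_norm.mp (hzK hm)).antisymm (le_norm_of_forall_le hg0 hr ?_)
        intro b hb
        have := hk b hb
        rw [map_sub] at this ⊢
        linarith
      have hyz := hy z hzK (carriesArc_of_norm_eq hE hr hk₁ hk₂ hk₁₂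
        (hle k₁ hk₁ (hmax k hkK).1) (hle k₂ hk₂ (hmax k hkK).2))
      have := hk _ hyz
      simp only [map_sub] at this
      linarith [hg k hkK]
  · obtain ⟨z, hzK, hz, hyz⟩ := exists_carriesArc_of_collinear hE hr hfin hK hZ hp hf hmax hcol
    exact absurd (hy z hzK hz) (not_le.mpr hyz)

end BallHull

theorem theorem3p9 {E : Type*} [NormedAddCommGroup E] [NormedSpace ℝ E]
    (hE : Module.finrank ℝ E = 2)
    (K : Set E) (hfin : K.Finite) (hne : K.Nonempty)
    (r : ℝ) (hr : 0 < r) (hrK : circumradius K ≤ r)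
    (h : StrictConvexSpace ℝ E ∨ Metric.diam K ≤ r) :
    (ballHull K r = ⋂ x ∈ {x : E | K ⊆ closedBall x r ∧ CarriesArc K x r}, closedBall x r) ∧
    ballHull K r = convexHull ℝ (minimalArcUnion K r) := by
  have : FiniteDimensional ℝ E := Module.finite_of_finrank_pos (by omega)
  have : ProperSpace E := FiniteDimensional.proper ℝ E
  have hZ := exists_subset_closedBall_of_circumradius_le hfin hne hrK
  refine ⟨Subset.antisymm ?_ (iInter_carriesArc_subset_ballHull hE hr hfin hne hZ h),
    Subset.antisymm (ballHull_subset_convexHull_minimalArcUnion hE hr hfin hne hZ)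
      (convexHull_min (minimalArcUnion_subset_ballHull hE hr hfin h) (convex_ballHull K r))⟩
  exact biInter_subset_biInter_left fun x hx => hx.1
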